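/- Let $n \ge 4$ and let $S$ be a set of $2n$ points in the Euclidean plane. A perfect matching on $S$ is a set of straight-line segments joining pairs of distinct points of $S$ such that every point of $S$ is an endpoint of exactly one of them. Two matchings are edge-disjoint if they have no segment in common. A graph whose vertices are the points of $S$ and whose edges are straight-line segments between points of $S$ is called plane (or non-crossing) if no two distinct edges have a common point that is interior to both, and triangle-free if no three of its vertices are pairwise joined by edges. (i) Suppose that $S$ is in general position, that is, no three points of $S$ lie on a common line. If $F_1, \dots, F_k$ are pairwise edge-disjoint non-crossing perfect matchings on $S$ whose union $F_1 \cup \dots \cup F_k$ is a triangle-free plane graph, then $k \le 3$. (ii) Suppose that $S$ is in convex position, that is, no point of $S$ lies in the convex hull of the other points of $S$. If $F_1, \dots, F_k$ are pairwise edge-disjoint non-crossing perfect matchings on $S$ whose union is a triangle-free plane graph, then $k \le 2$. -/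

import Mathlib

/-- The Euclidean plane. -/
abbrev Plane : Type := EuclideanSpace ℝ (Fin 2)

/-- A finite set of points of the plane is in general position if no three distinct points of it
lie on a common line. -/
def InGeneralPosition (S : Finset Plane) : Prop :=
  ∀ a ∈ S, ∀ b ∈ S, ∀ c ∈ S, a ≠ b → a ≠ c → b ≠ c → ¬ Collinear ℝ ({a, b, c} : Set Plane)

/-- A finite set of points of the plane is in convex position if no point of it lies in the convex
hull of the others. -/
def InConvexPosition (S : Finset Plane) : Prop :=
  ConvexIndependent ℝ ((↑) : S → Plane)

/-- The complete geometric graph on `S`: its vertices are the points of `S`, and the edge between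
two distinct points `a` and `b` is drawn as the straight-line segment from `a` to `b`. -/
abbrev completeGeometricGraph (S : Finset Plane) : SimpleGraph S := ⊤

/-- A geometric graph on `S` (a subgraph of the complete one) is plane, or non-crossing, if no two
distinct edges of it have a common point that is interior to both of them. -/
def IsNonCrossing {S : Finset Plane} (H : (completeGeometricGraph S).Subgraph) : Prop :=
  ∀ a b c d : S, H.Adj a b → H.Adj c d → s(a, b) ≠ s(c, d) →
    Disjoint (openSegment ℝ (a : Plane) (b : Plane)) (openSegment ℝ (c : Plane) (d : Plane))

/-- A family of `k` pairwise edge-disjoint non-crossing perfect matchings on `S` whose union is a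
triangle-free plane geometric graph. -/
structure IsTriangleFreePlanePacking (S : Finset Plane) (k : ℕ)
    (F : Fin k → (completeGeometricGraph S).Subgraph) : Prop where
  isPerfectMatching : ∀ i, (F i).IsPerfectMatching
  isNonCrossing : ∀ i, IsNonCrossing (F i)
  edgeDisjoint : ∀ i j, i ≠ j → Disjoint (F i).edgeSet (F j).edgeSet
  triangleFree : (⨆ i, F i).coe.CliqueFree 3
  union_isNonCrossing : IsNonCrossing (⨆ i, F i)

/-! The `k` matchings give every point `k` distinct neighbours in the union, so it suffices to find
a vertex of degree at most 3, respectively at most 2, in the union.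

For general position this would follow from Euler's formula; here only an inequality is needed, and
it comes from linear algebra. With E edges and V vertices, the circulations form a space of
dimension at least E - V + 1. Summing, with weights `z`, the angles under which edges are seen gives
a function locally constant off the edges that jumps by 4π `z u v` across the edge `u v`. Its
one-sided limits do not change when the face boundary is followed around a corner
(`IsPlaneDrawing.exists_next`), so they define a function on the orbits of a next-dart map. The
jumps recover the circulation, hence E - V + 1 is at most the number of orbits. Without triangles,
and with all degrees at least 4, every orbit class has at least four of the 2E darts. Thus E ≤ 2V -
2, against 2E ≥ 4V.

For convex position, sorting the points by angle around an extreme one makes every increasing triple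
positively oriented, so edges with interleaved endpoints cross. A shortest edge spanning a vertex
then exhibits one of degree at most 2 (`exists_degree_le_two_of_linearOrder`). -/

open Filter Topology

/-! ### Plane drawings and the winding function of a circulation -/

/-- A straight-line drawing of a graph in the complex plane in which no vertex lies on an edge it
is not an endpoint of, and edges do not cross. -/
structure IsPlaneDrawing {V : Type*} (G : SimpleGraph V) (x : V → ℂ) : Prop where
  injective : Function.Injective x
  vertex_notMem : ∀ a b c, G.Adj a b → c ≠ a → c ≠ b → x c ∉ openSegment ℝ (x a) (x b)
  disjoint : ∀ a b c d, G.Adj a b → G.Adj c d → s(a, b) ≠ s(c, d) →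
    Disjoint (openSegment ℝ (x a) (x b)) (openSegment ℝ (x c) (x d))

/-- A real circulation: an antisymmetric function on darts with zero net flow at each vertex. -/
structure IsCirculation {V : Type*} [Fintype V] (G : SimpleGraph V) (z : V → V → ℝ) : Prop where
  antisymm : ∀ a b, z a b = -z b a
  support : ∀ a b, z a b ≠ 0 → G.Adj a b
  sum_eq_zero : ∀ a, ∑ b, z a b = 0

/-- The total angle under which the circulation `z` is seen from the point `p`. -/
noncomputable def windingSum {V : Type*} [Fintype V] (x : V → ℂ) (z : V → V → ℝ) (p : ℂ) : ℝ :=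
  ∑ a, ∑ b, z a b * Complex.arg ((x b - p) / (x a - p))

/-- A nonpositive real quotient would place `p` between `a` and `b`. So the viewing angle meets the
branch cut of `arg` only on the segment itself. -/
theorem div_mem_slitPlane_of_notMem_segment {a b p : ℂ} (h : p ∉ segment ℝ a b) :
    (b - p) / (a - p) ∈ Complex.slitPlane := by
  by_contra hx
  rw [Complex.mem_slitPlane_iff, not_or, not_lt, not_not] at hx
  obtain ⟨hre, him⟩ := hx
  have ha : a - p ≠ 0 := by
    intro h0
    rw [sub_eq_zero] at h0
    exact h (h0 ▸ left_mem_segment ℝ a b)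
  set t : ℝ := -((b - p) / (a - p)).re with ht
  have ht0 : 0 ≤ t := by linarith
  have hx : (b - p) / (a - p) = -(t : ℂ) := by
    apply Complex.ext <;> simp [ht, him]
  rw [div_eq_iff ha] at hx
  have h1 : (1 : ℂ) + t ≠ 0 := by
    have : (1 : ℝ) + t ≠ 0 := by positivity
    exact_mod_cast this
  refine h ⟨t / (1 + t), 1 / (1 + t), by positivity, by positivity, by field_simp; ring, ?_⟩
  simp only [Complex.real_smul]
  push_cast
  field_simp
  linear_combination hx

theorem hasDerivAt_arg_div {a b : ℂ} {γ : ℝ → ℂ} {γ' : ℂ} {s : ℝ} (hγ : HasDerivAt γ γ' s)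
    (h : γ s ∉ segment ℝ a b) :
    HasDerivAt (fun s => Complex.arg ((b - γ s) / (a - γ s)))
      (γ' / (γ s - b) - γ' / (γ s - a)).im s := by
  have ha : a - γ s ≠ 0 := by
    intro h0
    rw [sub_eq_zero] at h0
    exact h (h0 ▸ left_mem_segment ℝ a b)
  have hb : b - γ s ≠ 0 := by
    intro h0
    rw [sub_eq_zero] at h0
    exact h (h0 ▸ right_mem_segment ℝ a b)
  have ha' : γ s - a ≠ 0 := by rw [← neg_sub]; exact neg_ne_zero.2 ha
  have hb' : γ s - b ≠ 0 := by rw [← neg_sub]; exact neg_ne_zero.2 hb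
  have h1 := ((hγ.const_sub b).fun_div (hγ.const_sub a) ha).clog_real
    (div_mem_slitPlane_of_notMem_segment h)
  have h2 := Complex.imCLM.hasFDerivAt.comp_hasDerivAt s h1
  have h3 : (γ' / (γ s - b) - γ' / (γ s - a)) =
      (-γ' * (a - γ s) - (b - γ s) * -γ') / (a - γ s) ^ 2 / ((b - γ s) / (a - γ s)) := by
    rw [show b - γ s = -(γ s - b) by ring, show a - γ s = -(γ s - a) by ring]
    field_simp
  rw [h3]
  simpa [Function.comp_def, Complex.log_im] using h2

/-- Along its own edge the angle is constantly π, on the branch cut. Both quotients in the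
derivative formula are real there, so the formula persists with value 0 and can be summed together
with the other edges. -/
theorem hasDerivAt_arg_div_openSegment {u v : ℂ} (huv : u ≠ v) {s : ℝ} (h0 : 0 < s) (h1 : s < 1) :
    HasDerivAt (fun s : ℝ => Complex.arg ((v - (u + s * (v - u))) / (u - (u + s * (v - u)))))
      ((v - u) / ((u + s * (v - u)) - v) - (v - u) / ((u + s * (v - u)) - u)).im s := by
  have hd : v - u ≠ 0 := sub_ne_zero.2 huv.symm
  have e : ((v - u) / ((u + s * (v - u)) - v) - (v - u) / ((u + s * (v - u)) - u)).im = 0 := by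
    have hs : (s : ℂ) ≠ 0 := by exact_mod_cast h0.ne'
    have hs1 : (s : ℂ) - 1 ≠ 0 := by
      rw [sub_ne_zero]; exact_mod_cast h1.ne
    rw [show (u + s * (v - u)) - v = (s - 1) * (v - u) by ring,
      show (u + s * (v - u)) - u = s * (v - u) by ring, div_mul_cancel_right₀ hd,
      div_mul_cancel_right₀ hd]
    have : ((s : ℂ) - 1)⁻¹ - (s : ℂ)⁻¹ = (((s - 1)⁻¹ - s⁻¹ : ℝ) : ℂ) := by push_cast; rfl
    rw [this, Complex.ofReal_im]
  rw [e]
  refine (hasDerivAt_const s Real.pi).congr_of_eventuallyEq ?_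
  filter_upwards [Ioo_mem_nhds h0 h1] with t ht
  have hs : (t : ℂ) ≠ 0 := by exact_mod_cast ht.1.ne'
  have : (v - (u + t * (v - u))) / (u - (u + t * (v - u))) = ((-((1 - t) / t) : ℝ) : ℂ) := by
    push_cast
    rw [show v - (u + t * (v - u)) = (1 - t) * (v - u) by ring,
      show u - (u + t * (v - u)) = - t * (v - u) by ring, mul_div_mul_right _ _ hd]
    field_simp
  rw [this, Complex.arg_ofReal_of_neg]
  have := div_pos (sub_pos.2 ht.2) ht.1
  linarith

section
variable {V : Type*} [Fintype V] {G : SimpleGraph V} {x : V → ℂ} {z : V → V → ℝ}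

/-- The derivative regroups by vertices, and the coefficient of each vertex is its net flow, which
vanishes. -/
theorem hasDerivAt_windingSum (hz : IsCirculation G z) {γ : ℝ → ℂ} {γ' : ℂ} {s : ℝ}
    (h : ∀ a b, G.Adj a b → HasDerivAt (fun s => Complex.arg ((x b - γ s) / (x a - γ s)))
      (γ' / (γ s - x b) - γ' / (γ s - x a)).im s) :
    HasDerivAt (fun s => windingSum x z (γ s)) 0 s := by
  have h1 : ∀ a b, HasDerivAt (fun s => z a b * Complex.arg ((x b - γ s) / (x a - γ s)))
      (z a b * (γ' / (γ s - x b) - γ' / (γ s - x a)).im) s := by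
    intro a b
    by_cases hab : z a b = 0
    · simpa [hab] using hasDerivAt_const s (0 : ℝ)
    · exact (h a b (hz.support a b hab)).const_mul _
  have h2 := HasDerivAt.fun_sum (u := Finset.univ) fun a _ =>
    HasDerivAt.fun_sum (u := Finset.univ) fun b _ => h1 a b
  have e : ∑ a, ∑ b, z a b * (γ' / (γ s - x b) - γ' / (γ s - x a)).im = 0 := by
    simp only [Complex.sub_im, mul_sub, Finset.sum_sub_distrib]
    rw [Finset.sum_comm]
    have e1 : ∀ b, ∑ a, z a b = 0 := by
      intro b
      rw [Finset.sum_congr rfl fun a _ => hz.antisymm a b, Finset.sum_neg_distrib,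
        hz.sum_eq_zero, neg_zero]
    simp [← Finset.sum_mul, hz.sum_eq_zero, e1]
  rw [e] at h2
  exact h2

omit [Fintype V] in
theorem IsPlaneDrawing.notMem_segment (hG : IsPlaneDrawing G x) {a b u v : V} (huv : G.Adj u v)
    (hab : G.Adj a b) (hne : s(a, b) ≠ s(u, v)) {q : ℂ} (hq : q ∈ openSegment ℝ (x u) (x v)) :
    q ∉ segment ℝ (x a) (x b) := by
  have key : ∀ c, x c ∉ openSegment ℝ (x u) (x v) := by
    intro c hc
    by_cases h1 : c = u
    · subst h1
      exact huv.ne (hG.injective (left_mem_openSegment_iff.1 hc))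
    by_cases h2 : c = v
    · subst h2
      exact huv.ne (hG.injective (right_mem_openSegment_iff.1 hc))
    exact hG.vertex_notMem u v c huv h1 h2 hc
  rw [← insert_endpoints_openSegment]
  rintro (rfl | rfl | h)
  · exact key _ hq
  · exact key _ hq
  · exact Set.disjoint_left.1 (hG.disjoint a b u v hab huv hne) h hq

theorem windingSum_eq_on_edge (hG : IsPlaneDrawing G x) (hz : IsCirculation G z) {u v : V}
    (huv : G.Adj u v) {s t : ℝ} (hs : s ∈ Set.Ioo (0 : ℝ) 1) (ht : t ∈ Set.Ioo (0 : ℝ) 1) :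
    windingSum x z (x u + s * (x v - x u)) = windingSum x z (x u + t * (x v - x u)) := by
  have hne : x u ≠ x v := hG.injective.ne huv.ne
  have hd : ∀ s ∈ Set.Ioo (0 : ℝ) 1,
      HasDerivAt (fun s : ℝ => windingSum x z (x u + s * (x v - x u))) 0 s := by
    intro s hs
    have hγ : HasDerivAt (fun s : ℝ => x u + s * (x v - x u)) (x v - x u) s := by
      simpa using ((Complex.ofRealCLM.hasDerivAt (x := s)).mul_const (x v - x u)).const_add (x u)
    refine hasDerivAt_windingSum (γ' := x v - x u) hz fun a b hab => ?_
    by_cases he : s(a, b) = s(u, v)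
    · rcases Sym2.eq_iff.1 he with ⟨rfl, rfl⟩ | ⟨rfl, rfl⟩
      · exact hasDerivAt_arg_div_openSegment hne hs.1 hs.2
      -- The reversed dart is handled by the parameter change `s ↦ 1 - s`.
      · have h1 := (hasDerivAt_arg_div_openSegment hne.symm (s := 1 - s) (sub_pos.2 hs.2)
          (by linarith [hs.1])).scomp s ((hasDerivAt_id s).const_sub 1)
        have e : ∀ s : ℝ, x a + ((1 - s : ℝ) : ℂ) * (x b - x a) = x b + s * (x a - x b) := by
          intro s; push_cast; ring
        simp only [Function.comp_def, e] at h1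
        refine h1.congr_deriv ?_
        rw [show x b - x a = -(x a - x b) by ring]
        simp only [neg_div, Complex.sub_im, Complex.neg_im, smul_eq_mul]
        ring
    · refine hasDerivAt_arg_div hγ (hG.notMem_segment huv hab he ?_)
      refine ⟨1 - s, s, sub_pos.2 hs.2, hs.1, by ring, ?_⟩
      simp only [Complex.real_smul]; push_cast; ring
  exact isOpen_Ioo.is_const_of_deriv_eq_zero isPreconnected_Ioo
    (fun s hs => (hd s hs).differentiableAt.differentiableWithinAt)
    (fun s hs => (hd s hs).deriv) hs ht

/-- At `q` both darts of the edge have angle π and their weights cancel. Approaching from the left,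
`u v` keeps π while `v u` tends to -π, which adds -2π `z v u` = 2π `z u v`. All other angles are
continuous at `q`. -/
theorem tendsto_windingSum_side (hG : IsPlaneDrawing G x) (hz : IsCirculation G z) {u v : V}
    (huv : G.Adj u v) {q : ℂ} (hq : q ∈ openSegment ℝ (x u) (x v)) :
    Tendsto (windingSum x z) (𝓝[{p | 0 < ((p - x u) / (x v - x u)).im}] q)
      (𝓝 (windingSum x z q + 2 * Real.pi * z u v)) := by
  classical
  have hd : x v - x u ≠ 0 := sub_ne_zero.2 (hG.injective.ne huv.ne.symm)
  obtain ⟨c, s, hc, hs, hcs, rfl⟩ := hq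
  have hc' : c = 1 - s := by linarith
  subst hc'
  set q : ℂ := (1 - s) • x u + s • x v with hqd
  have hq1 : q - x u = s * (x v - x u) := by
    simp only [hqd, Complex.real_smul]; push_cast; ring
  have hq2 : x v - q = (1 - s) * (x v - x u) := by
    simp only [hqd, Complex.real_smul]; push_cast; ring
  have hs0 : (s : ℂ) ≠ 0 := by exact_mod_cast hs.ne'
  have hs1 : (1 : ℂ) - s ≠ 0 := by
    have := hc.ne'
    exact_mod_cast this
  have hqu : x u - q ≠ 0 := by rw [← neg_sub, hq1]; exact neg_ne_zero.2 (mul_ne_zero hs0 hd)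
  have hqv : x v - q ≠ 0 := by rw [hq2]; exact mul_ne_zero hs1 hd
  have r1 : (x v - q) / (x u - q) = ((-((1 - s) / s) : ℝ) : ℂ) := by
    rw [← neg_sub q (x u), hq1, hq2]; push_cast; field_simp
  have r2 : (x u - q) / (x v - q) = ((-(s / (1 - s)) : ℝ) : ℂ) := by
    rw [← neg_sub q (x u), hq1, hq2]; push_cast; field_simp
  have n1 : -((1 - s) / s) < 0 := neg_neg_of_pos (div_pos hc hs)
  have n2 : -(s / (1 - s)) < 0 := neg_neg_of_pos (div_pos hs hc)
  have im1 : ∀ p : ℂ, 0 < ((p - x u) / (x v - x u)).im → 0 < ((x v - p) / (x u - p)).im := by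
    intro p hp
    set y := (p - x u) / (x v - x u) with hy
    have hy0 : y ≠ 0 := by rintro h; simp [h] at hp
    have hpu : p - x u ≠ 0 := by rintro h; simp [hy, h] at hp
    have hpu' : x u - p ≠ 0 := by rw [← neg_sub]; exact neg_ne_zero.2 hpu
    have : (x v - p) / (x u - p) = 1 - y⁻¹ := by
      rw [hy, inv_div, div_eq_iff hpu', ← neg_sub p (x u)]
      field_simp
      ring
    rw [this, Complex.sub_im, Complex.inv_im, Complex.one_im]
    have := div_pos hp (Complex.normSq_pos.2 hy0)
    linarith [neg_div (Complex.normSq y) y.im]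
  have im2 : ∀ p : ℂ, 0 < ((p - x u) / (x v - x u)).im → ((x u - p) / (x v - p)).im < 0 := by
    intro p hp
    have h := im1 p hp
    rw [← inv_div, Complex.inv_im]
    have h0 : (x v - p) / (x u - p) ≠ 0 := by rintro h0; simp [h0] at h
    exact div_neg_of_neg_of_pos (neg_neg_of_pos h) (Complex.normSq_pos.2 h0)
  have hcont : ∀ a b : V, x a - q ≠ 0 →
      ContinuousAt (fun p => (x b - p) / (x a - p)) q := fun a b h =>
    (continuousAt_const.sub continuousAt_id).div (continuousAt_const.sub continuousAt_id) h
  have key : ∀ a b, Tendsto (fun p => z a b * Complex.arg ((x b - p) / (x a - p)))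
      (𝓝[{p | 0 < ((p - x u) / (x v - x u)).im}] q)
      (𝓝 (z a b * Complex.arg ((x b - q) / (x a - q)) +
        if a = v then (if b = u then 2 * Real.pi * z u v else 0) else 0)) := by
    intro a b
    by_cases hab0 : z a b = 0
    · have : (if a = v then (if b = u then 2 * Real.pi * z u v else 0) else 0) = 0 := by
        split_ifs with h1 h2
        · subst h1 h2; rw [hz.antisymm, hab0]; simp
        · rfl
        · rfl
      simpa [hab0, this] using tendsto_const_nhds
    have hab := hz.support a b hab0
    by_cases he : s(a, b) = s(u, v)
    · rcases Sym2.eq_iff.1 he with ⟨rfl, rfl⟩ | ⟨rfl, rfl⟩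
      · rw [if_neg huv.ne, add_zero]
        refine Tendsto.const_mul _ ?_
        have h1 := Complex.continuousWithinAt_arg_of_re_neg_of_im_zero
          (z := (x b - q) / (x a - q)) (by rw [r1]; simpa using n1) (by rw [r1]; simp)
        refine h1.tendsto.comp (tendsto_nhdsWithin_iff.2 ⟨(hcont a b hqu).tendsto.mono_left
          nhdsWithin_le_nhds, ?_⟩)
        filter_upwards [self_mem_nhdsWithin] with p hp using (im1 p hp).le
      · rw [if_pos rfl, if_pos rfl]
        have h1 := Complex.tendsto_arg_nhdsWithin_im_neg_of_re_neg_of_im_zero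
          (z := (x b - q) / (x a - q)) (by rw [r2, Complex.ofReal_re]; exact n2)
          (by rw [r2, Complex.ofReal_im])
        have h2 : Complex.arg ((x b - q) / (x a - q)) = Real.pi := by
          rw [r2, Complex.arg_ofReal_of_neg n2]
        have h3 : z a b * Complex.arg ((x b - q) / (x a - q)) + 2 * Real.pi * z b a
            = z a b * -Real.pi := by rw [h2, hz.antisymm b a]; ring
        rw [h3]
        refine Tendsto.const_mul _ (h1.comp (tendsto_nhdsWithin_iff.2
          ⟨(hcont a b hqv).tendsto.mono_left nhdsWithin_le_nhds, ?_⟩))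
        filter_upwards [self_mem_nhdsWithin] with p hp using im2 p hp
    · have hns := hG.notMem_segment huv hab he (q := q) ⟨1 - s, s, hc, hs, hcs, rfl⟩
      have : (if a = v then (if b = u then 2 * Real.pi * z u v else 0) else 0) = 0 := by
        split_ifs with h1 h2
        · subst h1 h2; exact absurd Sym2.eq_swap he
        · rfl
        · rfl
      rw [this, add_zero]
      refine Tendsto.const_mul _ ?_
      have ha : x a - q ≠ 0 := by
        intro h0
        rw [sub_eq_zero] at h0
        exact hns (h0 ▸ left_mem_segment ℝ (x a) (x b))
      exact ((Complex.continuousAt_arg (div_mem_slitPlane_of_notMem_segment hns)).tendsto.comp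
        (hcont a b ha).tendsto).mono_left nhdsWithin_le_nhds
  have := tendsto_finsetSum Finset.univ fun a _ => tendsto_finsetSum Finset.univ fun b _ => key a b
  simp only [Finset.sum_add_distrib, Finset.sum_ite_eq', Finset.sum_ite_irrel,
    Finset.sum_const_zero, Finset.mem_univ, if_true] at this
  exact this

end

/-! ### One-sided limits along edges and around corners -/

section
variable {V : Type*} [Fintype V] {G : SimpleGraph V} {x : V → ℂ} {z : V → V → ℝ}

/-- The value of `windingSum` immediately to the left of the dart from `u` to `v`. -/
noncomputable def leftWinding (x : V → ℂ) (z : V → V → ℝ) (u v : V) : ℝ :=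
  windingSum x z (x u + ((1 / 2 : ℝ) : ℂ) * (x v - x u)) + 2 * Real.pi * z u v

theorem leftWinding_sub_leftWinding_swap (hz : IsCirculation G z) (u v : V) :
    leftWinding x z u v - leftWinding x z v u = 4 * Real.pi * z u v := by
  have : x u + ((1 / 2 : ℝ) : ℂ) * (x v - x u) = x v + ((1 / 2 : ℝ) : ℂ) * (x u - x v) := by
    push_cast; ring
  rw [leftWinding, leftWinding, this, hz.antisymm v u]
  ring

theorem tendsto_windingSum_leftWinding (hG : IsPlaneDrawing G x) (hz : IsCirculation G z)
    {u v : V} (huv : G.Adj u v) {s : ℝ} (hs : s ∈ Set.Ioo (0 : ℝ) 1) :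
    Tendsto (windingSum x z)
      (𝓝[{p | 0 < ((p - x u) / (x v - x u)).im}] (x u + s * (x v - x u)))
      (𝓝 (leftWinding x z u v)) := by
  rw [leftWinding, ← windingSum_eq_on_edge hG hz huv hs (by norm_num)]
  refine tendsto_windingSum_side hG hz huv ⟨1 - s, s, sub_pos.2 hs.2, hs.1, by ring, ?_⟩
  simp only [Complex.real_smul]; push_cast; ring

theorem IsPlaneDrawing.exists_ball_disjoint (hG : IsPlaneDrawing G x) (v : V) :
    ∃ ρ > 0, ∀ a b, G.Adj a b → a ≠ v → b ≠ v →
      ∀ p ∈ Metric.ball (x v) ρ, p ∉ segment ℝ (x a) (x b) := by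
  have key : ∀ᶠ p in 𝓝 (x v), ∀ a b, G.Adj a b → a ≠ v → b ≠ v →
      p ∉ segment ℝ (x a) (x b) := by
    simp only [eventually_all]
    intro a b hab ha hb
    have hcl : IsClosed (segment ℝ (x a) (x b)) := by
      rw [segment_eq_image_lineMap]
      exact (isCompact_Icc.image (by fun_prop)).isClosed
    refine hcl.isOpen_compl.mem_nhds ?_
    rw [Set.mem_compl_iff, ← insert_endpoints_openSegment]
    rintro (h | h | h)
    · exact ha (hG.injective h.symm)
    · exact hb (hG.injective h.symm)
    · exact hG.vertex_notMem a b v hab ha.symm hb.symm h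
  obtain ⟨ρ, hρ, h⟩ := Metric.eventually_nhds_iff_ball.1 key
  exact ⟨ρ, hρ, fun a b hab ha hb p hp => h p hp a b hab ha hb⟩

/-- A small clockwise arc about `v` from the edge `u v` to `v w` meets no edge in between, so the
winding function is constant on it. It leaves the first edge on its left and arrives at the second
from its left. -/
theorem leftWinding_eq_of_corner (hG : IsPlaneDrawing G x) (hz : IsCirculation G z) {u v w : V}
    (huv : G.Adj u v) (hvw : G.Adj v w) {c ψ : ℝ} (hc : 0 < c) (hψ : 0 < ψ)
    (hw : x w - x v = c * Complex.exp (-(ψ * Complex.I)) * (x u - x v))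
    (hempty : ∀ b, G.Adj v b → ∀ θ ∈ Set.Ioo 0 ψ, ∀ c' : ℝ, 0 < c' →
      x b - x v ≠ c' * Complex.exp (-(θ * Complex.I)) * (x u - x v)) :
    leftWinding x z u v = leftWinding x z v w := by
  obtain ⟨ρ, hρ, hball⟩ := hG.exists_ball_disjoint v
  have huv0 : x u - x v ≠ 0 := sub_ne_zero.2 (hG.injective.ne huv.ne)
  have hvu0 : x v - x u ≠ 0 := sub_ne_zero.2 (hG.injective.ne huv.ne.symm)
  have hwv0 : x w - x v ≠ 0 := sub_ne_zero.2 (hG.injective.ne hvw.ne.symm)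
  -- The first two bounds put the ends of the arc inside the two edges; the last keeps it away from
  -- edges not incident to `v`.
  obtain ⟨r, hr0, hr⟩ : ∃ r : ℝ, 0 < r ∧ r < 1 ∧ r < c ∧ r * ‖x u - x v‖ < ρ := by
    have hn : 0 < ‖x u - x v‖ := norm_pos_iff.2 huv0
    obtain ⟨r, h0, h1⟩ := exists_between (show 0 < min 1 (min c (ρ / ‖x u - x v‖)) by positivity)
    simp only [lt_min_iff] at h1
    exact ⟨r, h0, h1.1, h1.2.1, (lt_div_iff₀ hn).1 h1.2.2⟩
  obtain ⟨hr1, hrc, hrρ⟩ := hr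
  set γ : ℝ → ℂ := fun θ => x v + r * Complex.exp (-(θ * Complex.I)) * (x u - x v) with hγ
  have hγd : ∀ θ : ℝ, HasDerivAt γ
      (r * (Complex.exp (-(θ * Complex.I)) * -Complex.I) * (x u - x v)) θ := by
    intro θ
    have h1 : HasDerivAt (fun θ : ℝ => -((θ : ℂ) * Complex.I)) (-Complex.I) θ := by
      simpa [Pi.neg_def] using ((Complex.ofRealCLM.hasDerivAt (x := θ)).mul_const Complex.I).neg
    exact ((h1.cexp.const_mul (r : ℂ)).mul_const (x u - x v)).const_add (x v)
  have hγc : Continuous γ := continuous_iff_continuousAt.2 fun θ => (hγd θ).continuousAt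
  have hexp : ∀ θ : ℝ, ‖Complex.exp (-(θ * Complex.I))‖ = 1 := by
    intro θ
    rw [← neg_mul, ← Complex.ofReal_neg, Complex.norm_exp_ofReal_mul_I]
  have hoff : ∀ θ ∈ Set.Ioo 0 ψ, ∀ b, G.Adj v b → γ θ ∉ segment ℝ (x v) (x b) := by
    intro θ hθ b hb hmem
    rw [segment_eq_image'] at hmem
    obtain ⟨τ, hτ, h⟩ := hmem
    simp only [hγ, Complex.real_smul, add_right_inj] at h
    have hτ0 : τ ≠ 0 := by
      rintro rfl
      have : (r : ℂ) ≠ 0 := by exact_mod_cast hr0.ne'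
      simp [this, huv0] at h
    have hτp : 0 < τ := lt_of_le_of_ne hτ.1 hτ0.symm
    refine hempty b hb θ hθ (r / τ) (by positivity) ?_
    have : (τ : ℂ) ≠ 0 := by exact_mod_cast hτ0
    push_cast
    field_simp
    linear_combination h
  have hd : ∀ θ ∈ Set.Ioo 0 ψ, HasDerivAt (fun θ => windingSum x z (γ θ)) 0 θ := by
    intro θ hθ
    refine hasDerivAt_windingSum hz (fun a b hab => hasDerivAt_arg_div (hγd θ) ?_)
    by_cases ha : a = v
    · subst ha; exact hoff θ hθ b hab
    by_cases hb : b = v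
    · subst hb; rw [segment_symm]; exact hoff θ hθ a hab.symm
    refine hball a b hab ha hb _ ?_
    rw [mem_ball_iff_norm]
    simp only [hγ, add_sub_cancel_left, norm_mul, hexp, Complex.norm_real, mul_one,
      Real.norm_of_nonneg hr0.le]
    exact hrρ
  set K := windingSum x z (γ (ψ / 2)) with hK
  have hconst : ∀ θ ∈ Set.Ioo 0 ψ, windingSum x z (γ θ) = K := fun θ hθ =>
    isOpen_Ioo.is_const_of_deriv_eq_zero isPreconnected_Ioo
      (fun s hs => (hd s hs).differentiableAt.differentiableWithinAt)
      (fun s hs => (hd s hs).deriv) hθ ⟨by linarith, by linarith⟩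
  have hsin : ∀ θ : ℝ, (Complex.exp (-(θ * Complex.I))).im = -Real.sin θ := by
    intro θ
    rw [← neg_mul, ← Complex.ofReal_neg, Complex.exp_ofReal_mul_I_im, Real.sin_neg]
  have e1 : leftWinding x z u v = K := by
    have h1 := tendsto_windingSum_leftWinding hG hz huv (s := 1 - r) ⟨by linarith, by linarith⟩
    have h0 : x u + ((1 - r : ℝ) : ℂ) * (x v - x u) = γ 0 := by
      simp only [hγ]; push_cast; simp; ring
    rw [h0] at h1
    have h2 : Tendsto γ (𝓝[>] 0) (𝓝[{p | 0 < ((p - x u) / (x v - x u)).im}] (γ 0)) := by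
      refine tendsto_nhdsWithin_iff.2 ⟨hγc.continuousAt.tendsto.mono_left nhdsWithin_le_nhds, ?_⟩
      filter_upwards [Ioo_mem_nhdsGT Real.pi_pos] with θ hθ
      have : (γ θ - x u) / (x v - x u) = 1 - r * Complex.exp (-(θ * Complex.I)) := by
        rw [div_eq_iff hvu0]; simp only [hγ]; ring
      change 0 < ((γ θ - _) / _).im
      rw [this, Complex.sub_im, Complex.im_ofReal_mul, hsin, Complex.one_im]
      have := mul_pos hr0 (Real.sin_pos_of_pos_of_lt_pi hθ.1 hθ.2)
      linarith
    refine tendsto_nhds_unique (h1.comp h2) (tendsto_const_nhds.congr' ?_)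
    filter_upwards [Ioo_mem_nhdsGT hψ] with θ hθ using (hconst θ hθ).symm
  have e2 : leftWinding x z v w = K := by
    have hc0 : (c : ℂ) ≠ 0 := by exact_mod_cast hc.ne'
    have h1 := tendsto_windingSum_leftWinding hG hz hvw (s := r / c)
      ⟨by positivity, (div_lt_one hc).2 hrc⟩
    have h0 : x v + ((r / c : ℝ) : ℂ) * (x w - x v) = γ ψ := by
      simp only [hγ, hw]; push_cast; field_simp
    rw [h0] at h1
    have h2 : Tendsto γ (𝓝[<] ψ) (𝓝[{p | 0 < ((p - x v) / (x w - x v)).im}] (γ ψ)) := by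
      refine tendsto_nhdsWithin_iff.2 ⟨hγc.continuousAt.tendsto.mono_left nhdsWithin_le_nhds, ?_⟩
      filter_upwards [Ioo_mem_nhdsLT (show ψ - Real.pi < ψ by linarith [Real.pi_pos])] with θ hθ
      have : (γ θ - x v) / (x w - x v) =
          ((r / c : ℝ) : ℂ) * Complex.exp (-(((θ - ψ : ℝ) : ℂ) * Complex.I)) := by
        rw [div_eq_iff hwv0, hw]
        simp only [hγ, add_sub_cancel_left]
        have : Complex.exp (-(θ * Complex.I)) =
            Complex.exp (-(((θ - ψ : ℝ) : ℂ) * Complex.I)) * Complex.exp (-(ψ * Complex.I)) := by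
          rw [← Complex.exp_add]; congr 1; push_cast; ring
        rw [this]; push_cast; field_simp
      change 0 < ((γ θ - _) / _).im
      rw [this, Complex.im_ofReal_mul, hsin]
      have := mul_pos (div_pos hr0 hc)
        (Real.sin_pos_of_pos_of_lt_pi (sub_pos.2 hθ.2) (by linarith [hθ.1]))
      rw [← Real.sin_neg, neg_sub]
      exact this
    refine tendsto_nhds_unique (h1.comp h2) (tendsto_const_nhds.congr' ?_)
    filter_upwards [Ioo_mem_nhdsLT hψ] with θ hθ using (hconst θ hθ).symm
  rw [e1, e2]

/-- Take for `w` the first neighbour of `v` met when turning clockwise from `u`. -/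
theorem IsPlaneDrawing.exists_next (hG : IsPlaneDrawing G x) {u v b : V} (huv : G.Adj u v)
    (hvb : G.Adj v b) (hub : u ≠ b) :
    ∃ w, G.Adj v w ∧ w ≠ u ∧ ∀ z, IsCirculation G z →
      leftWinding x z u v = leftWinding x z v w := by
  classical
  -- The clockwise angle from `u` to `w`, shifted by -π. Because of the sign, `u` itself counts as a
  -- full turn and has the largest value π.
  set A : V → ℝ := fun w => Complex.arg (-((x u - x v) / (x w - x v))) with hA
  have hsub : ∀ w, G.Adj v w → x w - x v ≠ 0 := fun w hw =>
    sub_ne_zero.2 (hG.injective.ne hw.ne.symm)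
  -- Otherwise `b` and `u` lie on one ray from `v`, so they coincide or the nearer one lies on the
  -- edge to the farther one.
  have hbne : A b ≠ Real.pi := by
    intro h
    rw [hA, Complex.arg_eq_pi_iff] at h
    obtain ⟨hre, him⟩ := h
    set t : ℝ := ((x u - x v) / (x b - x v)).re with ht
    have htp : 0 < t := by simpa using hre
    have hX : (x u - x v) / (x b - x v) = (t : ℂ) := by
      apply Complex.ext
      · simp [ht]
      · simpa using him
    rw [div_eq_iff (hsub b hvb)] at hX
    have htC : (t : ℂ) ≠ 0 := by exact_mod_cast htp.ne'
    rcases lt_trichotomy t 1 with h1 | h1 | h1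
    · refine hG.vertex_notMem v b u hvb huv.ne hub ⟨1 - t, t, sub_pos.2 h1, htp, by ring, ?_⟩
      simp only [Complex.real_smul]; push_cast; linear_combination -hX
    · rw [h1] at hX
      exact hub (hG.injective (by simpa using hX))
    · refine hG.vertex_notMem v u b huv.symm hvb.ne.symm hub.symm ⟨1 - 1 / t, 1 / t,
        sub_pos.2 ((div_lt_one htp).2 h1), by positivity, by ring, ?_⟩
      simp only [Complex.real_smul]; push_cast; field_simp; linear_combination hX
  obtain ⟨w, hw, hmin⟩ := Finset.exists_min_image (Finset.univ.filter fun w => G.Adj v w) A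
    ⟨b, by simpa using hvb⟩
  simp only [Finset.mem_filter, Finset.mem_univ, true_and] at hw hmin
  have hu0 := hsub u huv.symm
  have hAu : A u = Real.pi := by simp [hA, div_self hu0]
  have hwu : w ≠ u := by
    rintro rfl
    have := hmin b hvb
    rw [hAu] at this
    exact hbne (le_antisymm (Complex.arg_le_pi _) this)
  refine ⟨w, hw, hwu, fun z hz => ?_⟩
  have hw0 := hsub w hw
  set X := (x u - x v) / (x w - x v) with hX
  have hX0 : X ≠ 0 := div_ne_zero hu0 hw0
  have hpolar : X = ‖X‖ * Complex.exp (((A w + Real.pi : ℝ) : ℂ) * Complex.I) := by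
    have := Complex.norm_mul_exp_arg_mul_I (-X)
    rw [norm_neg] at this
    push_cast
    rw [add_mul, Complex.exp_add, Complex.exp_pi_mul_I]
    linear_combination this
  refine leftWinding_eq_of_corner hG hz huv hw (c := 1 / ‖X‖) (ψ := A w + Real.pi)
    (by positivity) (by linarith [Complex.neg_pi_lt_arg (-X)]) ?_ ?_
  · have hn : (‖X‖ : ℂ) ≠ 0 := by exact_mod_cast (norm_pos_iff.2 hX0).ne'
    have hXw : x u - x v = X * (x w - x v) := by rw [hX, div_mul_cancel₀ _ hw0]
    rw [hXw, hpolar, Complex.exp_neg]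
    have := Complex.exp_ne_zero (((A w + Real.pi : ℝ) : ℂ) * Complex.I)
    simp only [Complex.norm_mul, Complex.norm_exp_ofReal_mul_I, Complex.norm_real, norm_norm,
      mul_one]
    push_cast at this ⊢
    field_simp
  · intro b hb θ hθ c' hc' h
    have hlt : A b = θ - Real.pi := by
      have hb' : -((x u - x v) / (x b - x v)) = ((1 / c' : ℝ) : ℂ) *
          Complex.exp (((θ - Real.pi : ℝ) : ℂ) * Complex.I) := by
        have hcC : (c' : ℂ) ≠ 0 := by exact_mod_cast hc'.ne'
        rw [h, Complex.exp_neg]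
        push_cast
        rw [sub_mul, Complex.exp_sub, Complex.exp_pi_mul_I]
        have := Complex.exp_ne_zero ((θ : ℂ) * Complex.I)
        field_simp
      simp only [hA]
      rw [hb', Complex.arg_real_mul _ (by positivity), Complex.arg_exp_mul_I,
        toIocMod_eq_self]
      exact ⟨by linarith [hθ.1], by linarith [hθ.2, Complex.arg_le_pi (-X)]⟩
    have := hmin b hb
    linarith [hθ.2]

end

/-! ### Orientation of triples and non-crossing graphs on a linear order -/

/-- The signed area of the parallelogram spanned by `b - a` and `c - a`. -/
def signedArea (a b c : Plane) : ℝ :=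
  (b 0 - a 0) * (c 1 - a 1) - (b 1 - a 1) * (c 0 - a 0)

/-- The barycentric coordinates of `q` in the triangle `o p s` are ratios of signed areas, and the
hypotheses make them nonnegative. -/
theorem mem_convexHull_triple_of_signedArea {o p q s : Plane} (h1 : 0 < signedArea o p q)
    (h2 : 0 < signedArea o q s) (h3 : 0 < signedArea o p s) (h4 : signedArea p q s ≤ 0) :
    q ∈ convexHull ℝ ({o, p, s} : Set Plane) := by
  have hw : 0 ≤ -signedArea p q s / signedArea o p s := div_nonneg (by linarith) h3.le
  have hw1 : 0 ≤ signedArea o q s / signedArea o p s := (div_pos h2 h3).le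
  have hw2 : 0 ≤ signedArea o p q / signedArea o p s := (div_pos h1 h3).le
  have hsum : -signedArea p q s + signedArea o q s + signedArea o p q = signedArea o p s := by
    simp only [signedArea]; ring
  have hconv := convex_convexHull ℝ ({o, p, s} : Set Plane)
  have hmem := subset_convexHull ℝ ({o, p, s} : Set Plane)
  have key := hconv.sum_mem (t := Finset.univ)
    (w := ![-signedArea p q s / signedArea o p s, signedArea o q s / signedArea o p s,
      signedArea o p q / signedArea o p s]) (z := ![o, p, s])
    (by intro i _; fin_cases i <;> simpa)
    (by
      simp only [Fin.sum_univ_three, Matrix.cons_val_zero, Matrix.cons_val_one, Matrix.cons_val]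
      rw [← add_div, ← add_div, hsum, div_self h3.ne'])
    (by intro i _; apply hmem; fin_cases i <;> simp)
  convert key using 1
  simp only [Fin.sum_univ_three, Matrix.cons_val_zero, Matrix.cons_val_one, Matrix.cons_val]
  ext i
  have h3' := h3.ne'
  simp only [PiLp.add_apply, PiLp.smul_apply, smul_eq_mul]
  rw [div_mul_eq_mul_div, div_mul_eq_mul_div, div_mul_eq_mul_div, ← add_div, ← add_div,
    eq_div_iff h3']
  fin_cases i <;> simp [signedArea] <;> ring

theorem not_disjoint_openSegment_of_signedArea {a b c d : Plane} (h1 : 0 < signedArea a b c)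
    (h2 : 0 < signedArea a c d) (h3 : 0 < signedArea a b d) (h4 : 0 < signedArea b c d) :
    ¬ Disjoint (openSegment ℝ a c) (openSegment ℝ b d) := by
  -- The two triangulations of the quadrilateral have the same area, so the weights on the two
  -- diagonals share a denominator.
  have hsum : signedArea b c d + signedArea a b d = signedArea a c d + signedArea a b c := by
    simp only [signedArea]; ring
  have hp : 0 < signedArea b c d + signedArea a b d := by linarith
  have hp' : 0 < signedArea a c d + signedArea a b c := by linarith
  rw [Set.not_disjoint_iff]
  refine ⟨_, ⟨signedArea b c d / (signedArea b c d + signedArea a b d),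
    signedArea a b d / (signedArea b c d + signedArea a b d), div_pos h4 hp, div_pos h3 hp,
    by rw [← add_div, div_self hp.ne'], rfl⟩,
    ⟨signedArea a c d / (signedArea a c d + signedArea a b c),
    signedArea a b c / (signedArea a c d + signedArea a b c), div_pos h2 hp', div_pos h1 hp',
    by rw [← add_div, div_self hp'.ne'], ?_⟩⟩
  rw [hsum]
  ext i
  simp only [PiLp.add_apply, PiLp.smul_apply, smul_eq_mul]
  rw [div_mul_eq_mul_div, div_mul_eq_mul_div, div_mul_eq_mul_div, div_mul_eq_mul_div, ← add_div,
    ← add_div]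
  congr 1
  fin_cases i <;> simp [signedArea] <;> ring

theorem exists_degree_le_two_of_linearOrder {V : Type*} [Fintype V] [LinearOrder V] [Nonempty V]
    (G : SimpleGraph V) [DecidableRel G.Adj]
    (h : ∀ a b c d, a < b → b < c → c < d → G.Adj a c → ¬ G.Adj b d) :
    ∃ x, G.degree x ≤ 2 := by
  by_cases hlong : ∃ m, ∃ i j, G.Adj i j ∧ (∃ y, i < y ∧ y < j) ∧
      (Finset.univ.filter fun y => i < y ∧ y < j).card = m
  · classical
    -- Take an edge `i j` with the fewest, but at least one, vertices strictly between, and let `x`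
    -- be the first of these. Below `x` only `i` can be a neighbour; above it, minimality leaves
    -- only the immediate successor.
    obtain ⟨i, j, hij, ⟨y, hy⟩, hm⟩ := Nat.find_spec hlong
    have hmin := fun m hm' => Nat.find_min hlong (m := m) hm'
    rw [← hm] at hmin
    have hne : (Finset.univ.filter fun y => i < y ∧ y < j).Nonempty := ⟨y, by simpa using hy⟩
    obtain ⟨x, hx, hxmin⟩ := Finset.exists_min_image _ id hne
    simp only [Finset.mem_filter, Finset.mem_univ, true_and, id] at hx hxmin
    have hshort : ∀ k, G.Adj x k → x < k → k ≤ j ∧ ∀ t, x < t → ¬ t < k := by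
      intro k hk hxk
      have hkj : k ≤ j := by
        by_contra! hkj
        exact h i x j k hx.1 hx.2 hkj hij hk
      refine ⟨hkj, fun t hxt htk => ?_⟩
      refine hmin _ ?_ ⟨x, k, hk, ⟨t, hxt, htk⟩, rfl⟩
      apply Finset.card_lt_card
      rw [Finset.ssubset_iff_of_subset]
      · exact ⟨x, by simpa using hx, by simp⟩
      · intro s hs
        simp only [Finset.mem_filter, Finset.mem_univ, true_and] at hs ⊢
        exact ⟨hx.1.trans hs.1, hs.2.trans_le hkj⟩
    have hbelow : ∀ k, G.Adj x k → k < x → k = i := by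
      intro k hk hkx
      rcases lt_trichotomy k i with hki | hki | hki
      · exact absurd hij (h k i x j hki hx.1 hx.2 hk.symm)
      · exact hki
      · exact absurd (hxmin k ⟨hki, hkx.trans hx.2⟩) (not_le.2 hkx)
    refine ⟨x, ?_⟩
    by_contra! hdeg
    rw [← SimpleGraph.card_neighborFinset_eq_degree, Finset.two_lt_card] at hdeg
    simp only [SimpleGraph.mem_neighborFinset] at hdeg
    obtain ⟨a, ha, b, hb, c, hc, hab, hac, hbc⟩ := hdeg
    have habove : ∀ k l, G.Adj x k → G.Adj x l → x < k → x < l → k = l := by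
      intro k l hk hl h1 h2
      rcases lt_trichotomy k l with h3 | h3 | h3
      · exact absurd h3 ((hshort l hl h2).2 k h1)
      · exact h3
      · exact absurd h3 ((hshort k hk h1).2 l h2)
    have hside : ∀ k, G.Adj x k → x < k ∨ k = i := fun k hk =>
      (lt_or_gt_of_ne hk.ne).imp_right (hbelow k hk)
    rcases hside a ha with h1 | h1 <;> rcases hside b hb with h2 | h2 <;>
      rcases hside c hc with h3 | h3
    · exact hab (habove _ _ ha hb h1 h2)
    · exact hab (habove _ _ ha hb h1 h2)
    · exact hac (habove _ _ ha hc h1 h3)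
    · exact hbc (h2.trans h3.symm)
    · exact hbc (habove _ _ hb hc h2 h3)
    · exact hac (h1.trans h3.symm)
    · exact hab (h1.trans h2.symm)
    · exact hab (h1.trans h2.symm)
  · push Not at hlong
    replace hlong : ∀ i j, G.Adj i j → ∀ y, i < y → ¬ y < j :=
      fun i j hij y h1 h2 => hlong _ i j hij ⟨y, h1, h2⟩ rfl
    obtain ⟨x⟩ := ‹Nonempty V›
    refine ⟨x, ?_⟩
    by_contra! hdeg
    rw [← SimpleGraph.card_neighborFinset_eq_degree, Finset.two_lt_card] at hdeg
    simp only [SimpleGraph.mem_neighborFinset] at hdeg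
    obtain ⟨a, ha, b, hb, c, hc, hab, hac, hbc⟩ := hdeg
    have habove : ∀ k l, G.Adj x k → G.Adj x l → x < k → x < l → k = l := by
      intro k l hk hl h1 h2
      rcases lt_trichotomy k l with h3 | h3 | h3
      · exact absurd h3 (hlong x l hl k h1)
      · exact h3
      · exact absurd h3 (hlong x k hk l h2)
    have hbelow : ∀ k l, G.Adj x k → G.Adj x l → k < x → l < x → k = l := by
      intro k l hk hl h1 h2
      rcases lt_trichotomy k l with h3 | h3 | h3
      · exact absurd h2 (hlong k x hk.symm l h3)
      · exact h3
      · exact absurd h1 (hlong l x hl.symm k h3)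
    rcases lt_or_gt_of_ne ha.ne with h1 | h1 <;> rcases lt_or_gt_of_ne hb.ne with h2 | h2 <;>
      rcases lt_or_gt_of_ne hc.ne with h3 | h3
    · exact hab (habove _ _ ha hb h1 h2)
    · exact hab (habove _ _ ha hb h1 h2)
    · exact hac (habove _ _ ha hc h1 h3)
    · exact hbc (hbelow _ _ hb hc h2 h3)
    · exact hbc (habove _ _ hb hc h2 h3)
    · exact hac (hbelow _ _ ha hc h1 h3)
    · exact hab (hbelow _ _ ha hb h1 h2)
    · exact hab (hbelow _ _ ha hb h1 h2)

/-! ### Dimension count: circulations against face orbits -/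

section
variable {V : Type*} [Fintype V] {G : SimpleGraph V} {x : V → ℂ}

/-- Each class contains the four distinct elements `d`, `φ d`, `φ (φ d)`, `φ (φ (φ d))`; `φ` need
not be a bijection. -/
theorem four_mul_card_quot_le {D : Type*} [Fintype D] (φ : D → D)
    [Fintype (Quot fun a b => φ a = b)] (h1 : ∀ d, φ d ≠ d) (h2 : ∀ d, φ (φ d) ≠ d)
    (h3 : ∀ d, φ (φ (φ d)) ≠ d) :
    4 * Fintype.card (Quot fun a b => φ a = b) ≤ Fintype.card D := by
  classical
  have hφ : ∀ d, Quot.mk (fun a b => φ a = b) (φ d) = Quot.mk _ d :=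
    fun d => (Quot.sound (r := fun a b => φ a = b) rfl).symm
  rw [mul_comm, ← Finset.card_univ (α := D),
    Finset.card_eq_sum_card_fiberwise (f := Quot.mk fun a b => φ a = b) (t := Finset.univ)
    (by simp), ← smul_eq_mul, ← Finset.card_univ, ← Finset.sum_const]
  refine Finset.sum_le_sum fun q _ => ?_
  obtain ⟨d, rfl⟩ := Quot.exists_rep q
  have hcard : ({d, φ d, φ (φ d), φ (φ (φ d))} : Finset D).card = 4 := by
    rw [Finset.card_insert_of_notMem, Finset.card_insert_of_notMem, Finset.card_pair]
    · exact (h1 _).symm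
    · simp [(h1 (φ d)).symm, (h2 (φ d)).symm]
    · simp [(h1 d).symm, (h2 d).symm, (h3 d).symm]
  rw [← hcard]
  apply Finset.card_le_card
  intro e he
  simp only [Finset.mem_insert, Finset.mem_singleton] at he
  simp only [Finset.mem_filter, Finset.mem_univ, true_and]
  rcases he with rfl | rfl | rfl | rfl <;> simp [hφ]

open Classical in
/-- The antisymmetric flow given by a weight on each edge, an edge being oriented towards the
endpoint with the larger label. -/
noncomputable def edgeFlow (G : SimpleGraph V) (e : V → ℕ) :
    (G.edgeSet → ℝ) →ₗ[ℝ] (V → V → ℝ) where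
  toFun y a b := if h : G.Adj a b then (if e a < e b then 1 else -1) * y ⟨s(a, b), h⟩ else 0
  map_add' y y' := by
    ext a b
    by_cases h : G.Adj a b <;> simp [h, mul_add]
  map_smul' c y := by
    ext a b
    by_cases h : G.Adj a b <;> simp [h]

omit [Fintype V] in
theorem edgeFlow_antisymm {e : V → ℕ} (he : Function.Injective e) (y : G.edgeSet → ℝ) (a b : V) :
    edgeFlow G e y a b = -edgeFlow G e y b a := by
  by_cases h : G.Adj a b
  · have hs : (⟨s(a, b), h⟩ : G.edgeSet) = ⟨s(b, a), h.symm⟩ := Subtype.ext Sym2.eq_swap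
    rcases lt_or_gt_of_ne (he.ne h.ne) with hlt | hlt
    · simp [edgeFlow, h, h.symm, hs, hlt, hlt.le.not_gt]
    · simp [edgeFlow, h, h.symm, hs, hlt, hlt.le.not_gt]
  · have h' : ¬ G.Adj b a := fun h' => h h'.symm
    simp [edgeFlow, h, h']

omit [Fintype V] in
theorem edgeFlow_support {e : V → ℕ} (y : G.edgeSet → ℝ) (a b : V)
    (h : edgeFlow G e y a b ≠ 0) : G.Adj a b := by
  by_contra hab
  simp [edgeFlow, hab] at h

omit [Fintype V] in
theorem edgeFlow_injective (e : V → ℕ) : Function.Injective (edgeFlow G e) := by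
  rw [← LinearMap.ker_eq_bot, LinearMap.ker_eq_bot']
  intro y hy
  ext ⟨s, hs⟩
  induction s with
  | _ a b =>
    have h := congrFun (congrFun hy a) b
    have hab : G.Adj a b := hs
    by_cases hlt : e a < e b <;> simpa [edgeFlow, hab, hlt] using h

/-- The net outflow of `edgeFlow` at each vertex. -/
noncomputable def netFlow (G : SimpleGraph V) (e : V → ℕ) : (G.edgeSet → ℝ) →ₗ[ℝ] (V → ℝ) where
  toFun y a := ∑ b, edgeFlow G e y a b
  map_add' y y' := by ext a; simp [Finset.sum_add_distrib]
  map_smul' c y := by ext a; simp [Finset.mul_sum]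

/-- By antisymmetry the net flows sum to zero, so the constant function 1 is not attained. -/
theorem finrank_range_netFlow_lt [Nonempty V] {e : V → ℕ} (he : Function.Injective e) :
    Module.finrank ℝ (LinearMap.range (netFlow G e)) < Fintype.card V := by
  rw [← Module.finrank_fintype_fun_eq_card ℝ]
  apply Submodule.finrank_lt
  intro htop
  obtain ⟨y, hy⟩ : (fun _ => 1 : V → ℝ) ∈ LinearMap.range (netFlow G e) := htop ▸ trivial
  have h1 : ∑ a, netFlow G e y a = Fintype.card V := by simp [hy]
  have h2 : ∑ a, netFlow G e y a = -∑ a, netFlow G e y a := by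
    change ∑ a, ∑ b, edgeFlow G e y a b = -∑ a, ∑ b, edgeFlow G e y a b
    conv_lhs => rw [Finset.sum_comm]
    rw [← Finset.sum_neg_distrib]
    refine Finset.sum_congr rfl fun a _ => ?_
    rw [← Finset.sum_neg_distrib]
    exact Finset.sum_congr rfl fun b _ => edgeFlow_antisymm he y b a
  have h3 : (0 : ℝ) < Fintype.card V := by exact_mod_cast Fintype.card_pos
  linarith

theorem leftWinding_add (x : V → ℂ) (z z' : V → V → ℝ) (u v : V) :
    leftWinding x (z + z') u v = leftWinding x z u v + leftWinding x z' u v := by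
  simp only [leftWinding, windingSum, Pi.add_apply, add_mul, mul_add, Finset.sum_add_distrib]
  ring

theorem leftWinding_smul (x : V → ℂ) (c : ℝ) (z : V → V → ℝ) (u v : V) :
    leftWinding x (c • z) u v = c * leftWinding x z u v := by
  simp only [leftWinding, windingSum, Pi.smul_apply, smul_eq_mul, mul_assoc, ← Finset.mul_sum]
  ring

/-- A triangle-free plane straight-line graph has a vertex of degree at most three. -/
theorem IsPlaneDrawing.exists_degree_le_three [Nonempty V] [DecidableRel G.Adj]
    (hG : IsPlaneDrawing G x) (htri : G.CliqueFree 3) : ∃ v, G.degree v ≤ 3 := by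
  classical
  by_contra! hdeg
  have hother : ∀ d : G.Dart, ∃ b, G.Adj d.snd b ∧ d.fst ≠ b := by
    intro d
    have h1 : 1 < (G.neighborFinset d.snd).card := by
      rw [G.card_neighborFinset_eq_degree]; exact lt_trans (by norm_num) (hdeg d.snd)
    obtain ⟨b, hb, hne⟩ := Finset.exists_mem_ne h1 d.fst
    exact ⟨b, (G.mem_neighborFinset _ _).1 hb, hne.symm⟩
  have hnext : ∀ d : G.Dart, ∃ d' : G.Dart, d'.fst = d.snd ∧ d'.snd ≠ d.fst ∧
      ∀ z, IsCirculation G z → leftWinding x z d.fst d.snd = leftWinding x z d'.fst d'.snd := by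
    intro d
    obtain ⟨b, hb, hne⟩ := hother d
    obtain ⟨w, hw, hwu, h⟩ := hG.exists_next d.adj hb hne
    exact ⟨⟨(d.snd, w), hw⟩, rfl, hwu, h⟩
  choose φ hφ1 hφ2 hφ3 using hnext
  let _ : Fintype (Quot fun a b => φ a = b) := Fintype.ofFinite _
  -- No period 1 since darts join distinct vertices, no period 2 since the walk never turns straight
  -- back, no period 3 since that closes a triangle.
  have hquot := four_mul_card_quot_le φ
    (fun d h => d.adj.ne (by rw [← hφ1 d, h]))
    (fun d h => hφ2 d (by rw [← hφ1 (φ d), h]))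
    (fun d h => by
      have e1 : (φ (φ d)).snd = d.fst := by rw [← hφ1, h]
      have a1 := d.adj
      have a2 := (φ d).adj
      have a3 := (φ (φ d)).adj
      rw [hφ1] at a2
      rw [hφ1, e1] at a3
      exact htri _ (SimpleGraph.is3Clique_triple_iff.2 ⟨a1, a3.symm, a2⟩))
  rw [G.dart_card_eq_twice_card_edges] at hquot
  set e : V → ℕ := fun v => (Fintype.equivFin V v : ℕ)
  have he : Function.Injective e := Fin.val_injective.comp (Fintype.equivFin V).injective
  have hcirc : ∀ y : LinearMap.ker (netFlow G e), IsCirculation G (edgeFlow G e y) := fun y =>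
    ⟨edgeFlow_antisymm he y.1, edgeFlow_support y.1, fun a => congrFun (LinearMap.mem_ker.1 y.2) a⟩
  -- A circulation is sent to its left limits, constant on each class. It is injective because the
  -- difference of the limits on the two sides of an edge is 4π times the flow through it.
  let M : LinearMap.ker (netFlow G e) →ₗ[ℝ] ((Quot fun a b => φ a = b) → ℝ) :=
    { toFun := fun y => Quot.lift
        (fun d : G.Dart => leftWinding x (edgeFlow G e y) d.fst d.snd)
        (by rintro d _ rfl; exact hφ3 d _ (hcirc y))
      map_add' := by
        intro y y'
        ext q
        obtain ⟨d, rfl⟩ := Quot.exists_rep q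
        simp [leftWinding_add]
      map_smul' := by
        intro c y
        ext q
        obtain ⟨d, rfl⟩ := Quot.exists_rep q
        simp [leftWinding_smul] }
  have hM : Function.Injective M := by
    rw [← LinearMap.ker_eq_bot, LinearMap.ker_eq_bot']
    intro y hy
    have hd : ∀ u v, G.Adj u v → leftWinding x (edgeFlow G e y) u v = 0 := fun u v h =>
      congrFun hy (Quot.mk _ ⟨(u, v), h⟩)
    apply Subtype.ext
    apply edgeFlow_injective e
    ext u v
    rw [ZeroMemClass.coe_zero, map_zero]
    by_contra hne
    have h := edgeFlow_support _ _ _ hne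
    have := leftWinding_sub_leftWinding_swap (x := x) (hcirc y) u v
    rw [hd u v h, hd v u h.symm, sub_zero] at this
    exact (mul_ne_zero (by positivity) hne) this.symm
  have h1 := LinearMap.finrank_le_finrank_of_injective hM
  rw [Module.finrank_fintype_fun_eq_card] at h1
  have h2 := (netFlow G e).finrank_range_add_finrank_ker
  rw [Module.finrank_fintype_fun_eq_card, ← SimpleGraph.edgeFinset_card] at h2
  have h3 := finrank_range_netFlow_lt (G := G) he
  have h4 : 4 * Fintype.card V ≤ 2 * G.edgeFinset.card := by
    rw [← G.sum_degrees_eq_twice_card_edges, mul_comm, ← smul_eq_mul, ← Finset.card_univ,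
      ← Finset.sum_const]
    exact Finset.sum_le_sum fun v _ => hdeg v
  omega

end

/-! ### Angular order of points in convex position -/

theorem InConvexPosition.notMem_convexHull {S : Finset Plane} (hS : InConvexPosition S)
    {p : Plane} (hp : p ∈ S) {T : Set Plane} (hT : T ⊆ S) (hpT : p ∉ T) :
    p ∉ convexHull ℝ T := fun h =>
  convexIndependent_set_iff_notMem_convexHull_sdiff.1 hS p hp
    (convexHull_mono (fun q hq => Set.mem_sdiff_singleton.2
      ⟨hT hq, by rintro rfl; exact hpT hq⟩) h)

/-- Sort by angle around the lexicographically least point `o`, with `o` first. All other points lie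
in a half-plane, where comparing angles is transitive. A triple with the wrong orientation would put
its middle point in the hull of `o` and the other two. -/
theorem InConvexPosition.exists_strictTotalOrder {S : Finset Plane} (hS : InConvexPosition S)
    (hne : S.Nonempty) :
    ∃ r : S → S → Prop, IsStrictTotalOrder S r ∧
      ∀ a b c : S, r a b → r b c → 0 < signedArea a b c := by
  obtain ⟨o, ho, hmin⟩ := Finset.exists_min_image S (fun p => toLex (p 0, p 1)) hne
  have hhalf : ∀ p ∈ S, p ≠ o → o 0 < p 0 ∨ (o 0 = p 0 ∧ o 1 < p 1) := by
    intro p hp hpo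
    rcases Prod.Lex.toLex_le_toLex.1 (hmin p hp) with h | ⟨h1, h2⟩
    · exact Or.inl h
    · refine Or.inr ⟨h1, lt_of_le_of_ne h2 fun h3 => hpo ?_⟩
      ext i
      fin_cases i
      · exact h1.symm
      · exact h3.symm
  have htrans : ∀ p ∈ S, ∀ q ∈ S, ∀ s ∈ S, p ≠ o → q ≠ o → s ≠ o →
      0 < signedArea o p q → 0 < signedArea o q s → 0 < signedArea o p s := by
    intro p hp q hq s hs hpo hqo hso h1 h2
    have Hp := hhalf p hp hpo
    have Hq := hhalf q hq hqo
    have Hs := hhalf s hs hso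
    simp only [signedArea] at *
    rw [← sub_pos] at Hp Hq Hs
    rw [← sub_pos (b := o 1), eq_comm, ← sub_eq_zero] at Hp Hq Hs
    generalize p 0 - o 0 = px at *
    generalize p 1 - o 1 = py at *
    generalize q 0 - o 0 = qx at *
    generalize q 1 - o 1 = qy at *
    generalize s 0 - o 0 = sx at *
    generalize s 1 - o 1 = sy at *
    -- A point straight above `o` has the largest angle, so `p` and `q`, each followed by another
    -- point, are strictly to the right of `o`.
    have hqx : 0 < qx := by
      rcases Hq with h | ⟨rfl, h⟩
      · exact h
      · rcases Hs with h' | ⟨rfl, h'⟩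
        · nlinarith
        · simp at h2
    have hpx : 0 < px := by
      rcases Hp with h | ⟨rfl, h⟩
      · exact h
      · nlinarith
    have hsx : 0 ≤ sx := by
      rcases Hs with h | ⟨rfl, h⟩
      · exact h.le
      · exact le_rfl
    have key : qx * (px * sy - py * sx) = px * (qx * sy - qy * sx) + sx * (px * qy - py * qx) := by
      ring
    have : 0 < qx * (px * sy - py * sx) := by
      rw [key]
      exact add_pos_of_pos_of_nonneg (mul_pos hpx h2) (mul_nonneg hsx h1.le)
    exact (pos_iff_pos_of_mul_pos this).1 hqx
  have hbetween : ∀ p ∈ S, ∀ q ∈ S, p ≠ o → p ≠ q → ∀ t : ℝ, 0 < t → t ≤ 1 →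
      p 0 - o 0 = t * (q 0 - o 0) → p 1 - o 1 = t * (q 1 - o 1) → False := by
    intro p hp q hq hpo hpq t ht0 ht1 e0 e1
    refine hS.notMem_convexHull hp (T := {o, q}) ?_ (by simp [hpo, hpq]) ?_
    · rintro y (rfl | rfl)
      · exact ho
      · exact hq
    · rw [convexHull_pair]
      refine ⟨1 - t, t, sub_nonneg.2 ht1, ht0.le, by ring, ?_⟩
      ext i
      fin_cases i
      · simp only [Fin.zero_eta, PiLp.add_apply, PiLp.smul_apply, smul_eq_mul]; linarith
      · simp only [Fin.mk_one, PiLp.add_apply, PiLp.smul_apply, smul_eq_mul]; linarith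
  have hzero : ∀ p ∈ S, ∀ q ∈ S, p ≠ o → q ≠ o → p ≠ q → signedArea o p q ≠ 0 := by
    intro p hp q hq hpo hqo hpq h
    -- Zero area puts `p` and `q` on one ray from `o`, so the nearer one lies between `o` and the
    -- farther one, against convex position.
    obtain ⟨t, ht, e0, e1⟩ : ∃ t : ℝ, 0 < t ∧ p 0 - o 0 = t * (q 0 - o 0) ∧
        p 1 - o 1 = t * (q 1 - o 1) := by
      have Hp := hhalf p hp hpo
      have Hq := hhalf q hq hqo
      simp only [signedArea] at h
      rw [← sub_pos] at Hp Hq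
      rw [← sub_pos (b := o 1), eq_comm, ← sub_eq_zero] at Hp Hq
      generalize p 0 - o 0 = px at *
      generalize p 1 - o 1 = py at *
      generalize q 0 - o 0 = qx at *
      generalize q 1 - o 1 = qy at *
      rcases Hq with hq' | ⟨rfl, hq'⟩
      · rcases Hp with hp' | ⟨rfl, hp'⟩
        · refine ⟨px / qx, div_pos hp' hq', by field_simp, ?_⟩
          field_simp
          linarith
        · exfalso; nlinarith
      · rcases Hp with hp' | ⟨rfl, hp'⟩
        · exfalso; nlinarith
        · exact ⟨py / qy, div_pos hp' hq', by simp, by field_simp⟩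
    rcases le_total t 1 with h1 | h1
    · exact hbetween p hp q hq hpo hpq t ht h1 e0 e1
    · refine hbetween q hq p hp hqo hpq.symm t⁻¹ (by positivity) (inv_le_one_of_one_le₀ h1) ?_ ?_
      · rw [e0]; field_simp
      · rw [e1]; field_simp
  have hswap : ∀ p q : Plane, signedArea o q p = -signedArea o p q := fun p q => by
    simp only [signedArea]; ring
  have hself : ∀ p : Plane, signedArea o p p = 0 := fun p => by simp only [signedArea]; ring
  have ho' : ∀ p : Plane, signedArea o p o = 0 := fun p => by simp only [signedArea]; ring
  have hright : ∀ p q : Plane, 0 < signedArea o p q → q ≠ o := by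
    rintro p q h rfl
    exact h.ne' (ho' p)
  refine ⟨fun p q => ((p : Plane) = o ∧ (q : Plane) ≠ o) ∨
    ((p : Plane) ≠ o ∧ 0 < signedArea o p q), ?_, ?_⟩
  · refine { trichotomous := ?_, irrefl := ?_, trans := ?_ }
    · intro p q h1 h2
      by_contra hpq
      have hpq' : (p : Plane) ≠ q := fun h => hpq (Subtype.ext h)
      by_cases hp : (p : Plane) = o
      · exact h1 (Or.inl ⟨hp, fun h => hpq' (hp.trans h.symm)⟩)
      by_cases hq : (q : Plane) = o
      · exact h2 (Or.inl ⟨hq, hp⟩)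
      rcases lt_or_gt_of_ne (hzero p p.2 q q.2 hp hq hpq') with h | h
      · exact h2 (Or.inr ⟨hq, by rw [hswap]; linarith⟩)
      · exact h1 (Or.inr ⟨hp, h⟩)
    · rintro p (⟨h1, h2⟩ | ⟨h1, h2⟩)
      · exact h2 h1
      · exact h2.ne' (hself p)
    · rintro p q s (⟨h1, h2⟩ | ⟨h1, h2⟩) (⟨h3, h4⟩ | ⟨h3, h4⟩)
      · exact absurd h3 h2
      · exact Or.inl ⟨h1, hright _ _ h4⟩
      · exact absurd h3 (hright _ _ h2)
      · exact Or.inr ⟨h1, htrans p p.2 q q.2 s s.2 h1 h3 (hright _ _ h4) h2 h4⟩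
  · rintro p q s (⟨h1, h2⟩ | ⟨h1, h2⟩) (⟨h3, h4⟩ | ⟨h3, h4⟩)
    · exact absurd h3 h2
    · rw [h1]; exact h4
    · exact absurd h3 (hright _ _ h2)
    · have h5 := htrans p p.2 q q.2 s s.2 h1 h3 (hright _ _ h4) h2 h4
      by_contra! hle
      refine hS.notMem_convexHull q.2 (T := {o, (p : Plane), (s : Plane)}) ?_ ?_
        (mem_convexHull_triple_of_signedArea h2 h4 h5 hle)
      · rintro y (rfl | rfl | rfl)
        · exact ho
        · exact p.2
        · exact s.2
      · rintro (h | h | h)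
        · exact h3 h
        · rw [h] at h2; exact h2.ne' (hself _)
        · rw [h] at h4; exact h4.ne' (hself _)

/-! ### From packings to vertex degrees -/

section
variable {S : Finset Plane} {k : ℕ} {F : Fin k → (completeGeometricGraph S).Subgraph}

/-- Each matching supplies a partner of `v`, and edge-disjointness makes these partners distinct. -/
theorem IsTriangleFreePlanePacking.le_degree (hF : IsTriangleFreePlanePacking S k F)
    [DecidableRel (⨆ i, F i).spanningCoe.Adj] (v : S) : k ≤ (⨆ i, F i).spanningCoe.degree v := by
  have h : ∀ i, ∃ w, (F i).Adj v w := fun i =>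
    ((hF.isPerfectMatching i).1 ((hF.isPerfectMatching i).2 v)).exists
  choose m hm using h
  have hadj : ∀ i, m i ∈ (⨆ i, F i).spanningCoe.neighborFinset v := by
    intro i
    rw [SimpleGraph.mem_neighborFinset, SimpleGraph.Subgraph.spanningCoe_adj,
      SimpleGraph.Subgraph.iSup_adj]
    exact ⟨i, hm i⟩
  have hinj : Function.Injective m := by
    intro i j hij
    by_contra hne
    refine Set.disjoint_left.1 (hF.edgeDisjoint i j hne) (SimpleGraph.Subgraph.mem_edgeSet.2 (hm i)) ?_
    rw [hij]
    exact SimpleGraph.Subgraph.mem_edgeSet.2 (hm j)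
  rw [← SimpleGraph.card_neighborFinset_eq_degree]
  simpa using Finset.card_le_card_of_injOn (s := Finset.univ) m (fun i _ => hadj i) hinj.injOn

theorem IsTriangleFreePlanePacking.cliqueFree (hF : IsTriangleFreePlanePacking S k F) :
    (⨆ i, F i).spanningCoe.CliqueFree 3 := by
  intro t ht
  obtain ⟨a, b, c, hab, hac, hbc, -⟩ := SimpleGraph.is3Clique_iff.1 ht
  rw [SimpleGraph.Subgraph.spanningCoe_adj] at hab hac hbc
  classical
  refine hF.triangleFree {⟨a, hab.fst_mem⟩, ⟨b, hab.snd_mem⟩, ⟨c, hac.snd_mem⟩}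
    (SimpleGraph.is3Clique_triple_iff.2 ⟨?_, ?_, ?_⟩)
  · exact hab
  · exact hac
  · exact hbc

/-- General position is what keeps vertices off the interiors of edges; the isometry with ℂ
preserves open segments. -/
theorem IsTriangleFreePlanePacking.isPlaneDrawing (hF : IsTriangleFreePlanePacking S k F)
    (hS : InGeneralPosition S) :
    IsPlaneDrawing (⨆ i, F i).spanningCoe
      (fun p => Complex.orthonormalBasisOneI.repr.symm (p : Plane)) := by
  set T := Complex.orthonormalBasisOneI.repr.symm
  have hseg : ∀ a b : Plane, openSegment ℝ (T a) (T b) = T '' openSegment ℝ a b := fun a b =>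
    (image_openSegment ℝ (T.toLinearEquiv : Plane →ₗ[ℝ] ℂ).toAffineMap a b).symm
  refine ⟨T.injective.comp Subtype.val_injective, ?_, ?_⟩
  · intro a b c hab hca hcb hmem
    rw [hseg, T.injective.mem_set_image] at hmem
    exact hS a a.2 c c.2 b b.2 (Subtype.coe_ne_coe.2 hca.symm) (Subtype.coe_ne_coe.2 hab.ne)
      (Subtype.coe_ne_coe.2 hcb)
      (mem_segment_iff_wbtw.1 (openSegment_subset_segment _ _ _ hmem)).collinear
  · intro a b c d hab hcd hne
    rw [hseg, hseg, Set.disjoint_image_iff T.injective]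
    exact hF.union_isNonCrossing a b c d hab hcd hne

end

theorem mainTheorem6 (n : ℕ) (hn : 4 ≤ n) (S : Finset Plane) (hS : S.card = 2 * n) :
    (InGeneralPosition S →
      ∀ (k : ℕ) (F : Fin k → (completeGeometricGraph S).Subgraph),
        IsTriangleFreePlanePacking S k F → k ≤ 3) ∧
    (InConvexPosition S →
      ∀ (k : ℕ) (F : Fin k → (completeGeometricGraph S).Subgraph),
        IsTriangleFreePlanePacking S k F → k ≤ 2) := by
  classical
  have hne : Nonempty S := (Finset.card_pos.1 (by omega)).to_subtype
  refine ⟨fun hgp k F hF => ?_, fun hcp k F hF => ?_⟩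
  · obtain ⟨v, hv⟩ := (hF.isPlaneDrawing hgp).exists_degree_le_three hF.cliqueFree
    exact (hF.le_degree v).trans hv
  · obtain ⟨r, hr, hpos⟩ := hcp.exists_strictTotalOrder (Finset.nonempty_coe_sort.1 hne)
    let _ : LinearOrder S := linearOrderOfSTO r
    obtain ⟨v, hv⟩ := exists_degree_le_two_of_linearOrder (⨆ i, F i).spanningCoe (by
      intro a b c d hab hbc hcd hac hbd
      refine not_disjoint_openSegment_of_signedArea (hpos a b c hab hbc)
        (hpos a c d (hab.trans hbc) hcd) (hpos a b d hab (hbc.trans hcd)) (hpos b c d hbc hcd)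
        (hF.union_isNonCrossing a c b d hac hbd ?_)
      intro h
      rcases Sym2.eq_iff.1 h with ⟨h1, -⟩ | ⟨-, h1⟩
      · exact hab.ne h1
      · exact hbc.ne h1.symm)
    exact (hF.le_degree v).trans hv
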